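/- Let $\mathcal H$ be a complex Hilbert space and $(\mathcal K,[\cdot,\cdot])$ a Pontryagin space of negative index $\kappa$. For a bounded $\Gamma:\mathcal H\to\mathcal K$ let $\Gamma^+:\mathcal K\to\mathcal H$ be its adjoint, $(\Gamma^+k,h)=[k,\Gamma h]$. Linear relations in $\mathcal K$ are subspaces $T\subseteq\mathcal K\times\mathcal K$; write $T^+=\{(k,h):[k,g]=[h,f]\ \forall (f,g)\in T\}$ (so that $T$ is self-adjoint if $T=T^+$), $T_\infty=\{(0,g)\in T\}$, and let $\rho(T)$ be the set of $z\in\mathbb C$ for which $(T-z)^{-1}$ is a bounded operator defined on all of $\mathcal K$. Let $Q$ be a generalized Nevanlinna function in $N_\kappa(\mathcal H)$, minimally represented by $$Q(z)=\Gamma^+(A-z)^{-1}\Gamma,\qquad z\in\mathcal D(Q)=\rho(A),$$ where $A$ is a bounded self-adjoint operator in $\mathcal K$, $\Gamma:\mathcal H\to\mathcal K$ is bounded, and $\mathcal K$ is the closed linear span of $\{(A-z)^{-1}\Gamma h: z\in\rho(A),\,h\in\mathcal H\}$. Assume that $Q'(\infty):=\lim_{z\to\infty}zQ(z)$ (limit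 in operator norm) is boundedly invertible. Then $Q'(\infty)=-\Gamma^+\Gamma$; put $$P:=\Gamma(\Gamma^+\Gamma)^{-1}\Gamma^+ .$$ Let $\hat Q(z):=-Q(z)^{-1}$ on $\mathcal D(\hat Q)=\{z\in\rho(A): Q(z)\text{ is boundedly invertible}\}$, and put $\Gamma_z:=(A-z)^{-1}\Gamma$, $\hat\Gamma_z:=-\Gamma_zQ(z)^{-1}$. A representing relation of $\hat Q$ is a self-adjoint linear relation $\hat A$ in $\mathcal K$ such that $\mathcal D(\hat Q)\cap\rho(\hat A)$ meets the open upper half-plane and, for all $z,w\in\mathcal D(\hat Q)\cap\rho(\hat A)$, $$\hat\Gamma_z=\bigl(I+(z-w)(\hat A-z)^{-1}\bigr)\hat\Gamma_w,\qquad \hat Q(z)=\hat Q(w)^*+(z-\bar w)\,\hat\Gamma_w^+\bigl(I+(z-w)(\hat A-z)^{-1}\bigr)\hat\Gamma_w,$$ and, for all $w\in\mathcal D(\hat Q)\cap\rho(\hat A)$, $\mathcal K$ is the closed linear span of $\{(I+(z-w)(\hat A-z)^{-1})\hat\Gamma_wh: z\in\rho(\hat A),\,h\in\mathcal H\}$.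 Then $\hat Q$ has exactly one representing relation $\hat A$, and it satisfies $$\hat A=A_{|(I-P)\mathcal K}\,\dot+\,\hat A_\infty,\qquad \hat A_\infty=\{0\}\times P\mathcal K,$$ where $A_{|(I-P)\mathcal K}=\{(x,Ax):x\in(I-P)\mathcal K\}$ and the sum of subspaces of $\mathcal K\times\mathcal K$ is direct. Moreover $\mathcal D(\hat Q)=\rho(A)\cap\rho(\hat A)$. -/

import Mathlib

open scoped ComplexConjugate InnerProductSpace Topology

noncomputable section

namespace PontryaginRep

variable {H K : Type*} [NormedAddCommGroup H] [InnerProductSpace ℂ H] [CompleteSpace H]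
  [NormedAddCommGroup K] [InnerProductSpace ℂ K] [CompleteSpace K]

/-! ### Pontryagin spaces

A Pontryagin space is given by its associated Hilbert space `K` together with the fundamental
symmetry `J` of a fundamental decomposition `K = K₊ ∔ K₋` (`J = 1` on `K₊`, `J = -1` on `K₋`). -/

/-- `J` is a fundamental symmetry on the Hilbert space `K` whose negative eigenspace has
dimension `κ`; that is, `(K, [·,·])` with `[x, y] = (J x, y)` is a Pontryagin space of
(negative) index `κ`. -/
structure IsPontryagin (κ : ℕ) (J : K →L[ℂ] K) : Prop where
  isSelfAdjoint : IsSelfAdjoint J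
  sq_eq_one : J ∘L J = 1
  finiteDimensional_neg :
    FiniteDimensional ℂ (LinearMap.ker ((J + 1 : K →L[ℂ] K) : K →ₗ[ℂ] K))
  finrank_neg : Module.finrank ℂ (LinearMap.ker ((J + 1 : K →L[ℂ] K) : K →ₗ[ℂ] K)) = κ

/-- The indefinite scalar product `[x, y] = (J x, y)`, linear in `x` and antilinear in `y`. -/
def ip (J : K →L[ℂ] K) (x y : K) : ℂ := ⟪y, J x⟫_ℂ

/-- The adjoint `Γ⁺ : K → H` of a bounded operator `Γ : H → K` from the Hilbert space `H` to the
space `(K, [·,·])`; it is characterized by `(Γ⁺ k, h) = [k, Γ h]`. -/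
def kadj (J : K →L[ℂ] K) (Γ : H →L[ℂ] K) : K →L[ℂ] H := ContinuousLinearMap.adjoint Γ ∘L J

theorem inner_kadj (J : K →L[ℂ] K) (Γ : H →L[ℂ] K) (k : K) (h : H) :
    ⟪h, kadj J Γ k⟫_ℂ = ip J k (Γ h) := by
  simp [kadj, ip, ContinuousLinearMap.adjoint_inner_right]

/-! ### Linear relations in `K` -/

/-- The graph of a bounded operator, as a linear relation. -/
def graphRel (A : K →L[ℂ] K) : Submodule ℂ (K × K) := (A : K →ₗ[ℂ] K).graph

/-- The restriction `A_{|M}` of an operator to a subspace, as a linear relation: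
`{(x, A x) : x ∈ M}`. -/
def restrictRel (A : K →L[ℂ] K) (M : Submodule ℂ K) : Submodule ℂ (K × K) :=
  M.map (LinearMap.prod LinearMap.id (A : K →ₗ[ℂ] K))

/-- The adjoint `T⁺ = {(k, h) : [k, g] = [h, f] for all (f, g) ∈ T}` of a linear relation. -/
def adjointRel (J : K →L[ℂ] K) (T : Submodule ℂ (K × K)) : Submodule ℂ (K × K) where
  carrier := {p | ∀ q ∈ T, ip J p.1 q.2 = ip J p.2 q.1}
  add_mem' := by
    intro a b ha hb q hq
    have h1 := ha q hq
    have h2 := hb q hq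
    simp only [ip] at h1 h2
    simp [ip, h1, h2]
  zero_mem' := by
    intro q _
    simp [ip]
  smul_mem' := by
    intro c a ha q hq
    have h1 := ha q hq
    simp only [ip] at h1
    simp [ip, h1]

/-- `T` is self-adjoint in `(K, [·,·])`: `T = T⁺`. -/
def IsSelfAdjointRel (J : K →L[ℂ] K) (T : Submodule ℂ (K × K)) : Prop := T = adjointRel J T

/-- The relation `(T - z)⁻¹ = {(g - z f, f) : (f, g) ∈ T}`. -/
def shiftInv (T : Submodule ℂ (K × K)) (z : ℂ) : Submodule ℂ (K × K) :=
  T.map (LinearMap.prod (LinearMap.snd ℂ K K - z • LinearMap.fst ℂ K K) (LinearMap.fst ℂ K K))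

/-- The resolvent set of a closed relation `T`: the points `z` for which `(T - z)⁻¹` is (the graph
of) a bounded operator defined on all of `K`. For a closed relation this is the same as being a
bounded operator with dense domain. -/
def rho (T : Submodule ℂ (K × K)) : Set ℂ := {z | ∃ R : K →L[ℂ] K, shiftInv T z = graphRel R}

open Classical in
/-- The resolvent operator `(T - z)⁻¹` for `z ∈ ρ(T)` (with the value `0` elsewhere). -/
def res (T : Submodule ℂ (K × K)) (z : ℂ) : K →L[ℂ] K :=
  if h : z ∈ rho T then h.choose else 0

set_option linter.unusedSectionVars false in
theorem shiftInv_eq_graphRel_res {T : Submodule ℂ (K × K)} {z : ℂ} (h : z ∈ rho T) :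
    shiftInv T z = graphRel (res T z) := by
  rw [res, dif_pos h]
  exact h.choose_spec

/-- The part `T_∞ = {(0, g) ∈ T}` of a relation. -/
def infPart (T : Submodule ℂ (K × K)) : Submodule ℂ (K × K) := T ⊓ Submodule.prod ⊥ ⊤

/-! ### Generalized Nevanlinna functions -/

open Classical in
/-- The Nevanlinna kernel `N_Q(z, w) = (Q(z) - Q(w)*) / (z - w̄)`, extended by continuity
to `z = w̄` (where it is `Q'(z)`). -/
def nevKernel (Q : ℂ → H →L[ℂ] H) (z w : ℂ) : H →L[ℂ] H :=
  if z = conj w then deriv Q z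
  else (z - conj w)⁻¹ • (Q z - ContinuousLinearMap.adjoint (Q w))

/-- The matrix of the form `∑ (N_Q(zᵢ, zⱼ) hᵢ, hⱼ) ξᵢ ξ̄ⱼ` in the variables `ξ`. -/
def nevMatrix (Q : ℂ → H →L[ℂ] H) {n : ℕ} (z : Fin n → ℂ) (h : Fin n → H) :
    Matrix (Fin n) (Fin n) ℂ :=
  fun j i => ⟪h j, nevKernel Q (z i) (z j) (h i)⟫_ℂ

/-- The number of negative eigenvalues, with multiplicity, of a Hermitian matrix. -/
def negCount {n : ℕ} {M : Matrix (Fin n) (Fin n) ℂ} (hM : M.IsHermitian) : ℕ :=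
  (Finset.univ.filter fun i => hM.eigenvalues i < 0).card

/-- `Q ∈ N_κ(H)` with domain of holomorphy `D`. Values of `Q` outside `D` play no role. -/
structure IsGenNevanlinna (κ : ℕ) (D : Set ℂ) (Q : ℂ → H →L[ℂ] H) : Prop where
  isOpen : IsOpen D
  holomorphic : DifferentiableOn ℂ Q D
  /-- the nonreal points outside `D` are isolated -/
  eventually_mem : ∀ z : ℂ, z.im ≠ 0 → ∀ᶠ w in 𝓝[≠] z, w ∈ D
  meromorphic : MeromorphicOn Q {z : ℂ | z.im ≠ 0}
  conj_mem : ∀ z ∈ D, conj z ∈ D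
  adjoint_eq : ∀ z ∈ D, ContinuousLinearMap.adjoint (Q z) = Q (conj z)
  /-- the kernel has at most `κ` negative squares ... -/
  negSquares_le : ∀ (n : ℕ) (z : Fin n → ℂ) (h : Fin n → H), (∀ i, z i ∈ D) →
    ∃ hM : (nevMatrix Q z h).IsHermitian, negCount hM ≤ κ
  /-- ... and `κ` of them are attained -/
  negSquares_attained : ∃ (n : ℕ) (z : Fin n → ℂ) (h : Fin n → H), (∀ i, z i ∈ D) ∧
    ∃ hM : (nevMatrix Q z h).IsHermitian, negCount hM = κ

/-! ### Representing relations -/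

/-- The operator `(I + (z - w)(T - z)⁻¹) Γ_w`. -/
def fieldAt (T : Submodule ℂ (K × K)) (w : ℂ) (Γw : H →L[ℂ] K) (z : ℂ) : H →L[ℂ] K :=
  (1 + (z - w) • res T z) ∘L Γw

/-- `T` is the representing relation in the minimal representation, with the field of operators
`z ↦ Γ_z = G z`, of the function `Q` with domain `D`. Here `T` is self-adjoint and
* `Γ_z = (I + (z - w)(T - z)⁻¹) Γ_w`,
* `Q(z) = Q(w)* + (z - w̄) Γ_w⁺ (I + (z - w)(T - z)⁻¹) Γ_w`

for all `z` and all reference points `w` in `D ∩ ρ(T)`, which meets the upper half-plane; and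
`K` is the closed linear span of the vectors `(I + (z - w)(T - z)⁻¹) Γ_w h`,
`z ∈ ρ(T)`, `h ∈ H`. -/
structure IsMinimalRepresentation (J : K →L[ℂ] K) (D : Set ℂ) (Q : ℂ → H →L[ℂ] H)
    (T : Submodule ℂ (K × K)) (G : ℂ → H →L[ℂ] K) : Prop where
  isSelfAdjoint : IsSelfAdjointRel J T
  exists_ref : ∃ w ∈ D ∩ rho T, 0 < w.im
  field_eq : ∀ w ∈ D ∩ rho T, ∀ z ∈ D ∩ rho T, G z = fieldAt T w (G w) z
  repr : ∀ w ∈ D ∩ rho T, ∀ z ∈ D ∩ rho T,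
    Q z = ContinuousLinearMap.adjoint (Q w) +
      (z - conj w) • (kadj J (G w) ∘L fieldAt T w (G w) z)
  minimal : ∀ w ∈ D ∩ rho T,
    (Submodule.span ℂ {x : K | ∃ z ∈ rho T, ∃ h : H, x = fieldAt T w (G w) z h}).topologicalClosure
      = ⊤

/-- The projection `P = Γ (Γ⁺ Γ)⁻¹ Γ⁺` (for boundedly invertible `Γ⁺ Γ`). -/
def proj (J : K →L[ℂ] K) (Γ : H →L[ℂ] K) : K →L[ℂ] K :=
  Γ ∘L Ring.inverse (kadj J Γ ∘L Γ) ∘L kadj J Γ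

/-- The range of a bounded operator on `K`, as a subspace. -/
def ran (P : K →L[ℂ] K) : Submodule ℂ K := LinearMap.range (P : K →ₗ[ℂ] K)

/-- The domain of `Q̂ = -Q⁻¹`: the points of `D` at which `Q` is boundedly invertible. -/
def invDomain (D : Set ℂ) (Q : ℂ → H →L[ℂ] H) : Set ℂ := {z | z ∈ D ∧ IsUnit (Q z)}

/-- `Q̂(z) = -Q(z)⁻¹`. -/
def negInv (Q : ℂ → H →L[ℂ] H) (z : ℂ) : H →L[ℂ] H := -Ring.inverse (Q z)

/-- The field `Γ̂_z = -Γ_z Q(z)⁻¹` of `Q̂ = -Q⁻¹`, for the field `Γ_z = (A - z)⁻¹ Γ` of `Q`. -/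
def hatField (A : K →L[ℂ] K) (Γ : H →L[ℂ] K) (Q : ℂ → H →L[ℂ] H) (z : ℂ) : H →L[ℂ] K :=
  -((res (graphRel A) z ∘L Γ) ∘L Ring.inverse (Q z))

end PontryaginRep

end

open scoped ComplexConjugate InnerProductSpace Topology

noncomputable section

namespace PontryaginRep

/-! ### Analytic continuation across isolated points -/

/-! Write `R_z = (A - z)⁻¹`. Since `Γ⁺Γ` is invertible, `P` projects onto `ran Γ` along `ker Γ⁺`, so
the asserted relation is `{(f, A f + Γ h) : Γ⁺ f = 0}` (`mem_hatRel`). Solving `(y, x + z y)` in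
this relation means `y = R_z (x - Γ h)` with `Γ⁺ y = 0`, that is, `Q(z) h = Γ⁺ R_z x`. When `Q(z)`
is invertible this yields Krein's formula `R_z - R_z Γ Q(z)⁻¹ Γ⁺ R_z` for the resolvent
(`shiftInv_hatRel`); conversely, unique solvability forces `Q(z)` to be bijective (`invDomain_eq`).
The representation identities then follow from the resolvent equation of `A` (`fieldAt_hatRel`,
`negInv_eq`).

Minimality and uniqueness both rest on one density fact (`topologicalClosure_span_res_eq_top`): the
vectors `R_z Γ h` with `z` in any open set that contains a nonreal point already span a dense
subspace. This is analytic continuation; the two half-planes are linked through a neighbourhood of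
infinity, where the bounded operator `A` has no spectrum. For uniqueness, the field identity
determines the resolvent at `w` on the range of every `Γ̂_u` with `u ≠ w`, hence on a dense set, and
a resolvent at one point determines its relation. -/

/-- A punctured open disc is preconnected. -/
theorem isPreconnected_ball_diff_center (c : ℂ) {r : ℝ} (hr : 0 < r) :
    IsPreconnected (Metric.ball c r \ {c}) := by
  -- The punctured disc is a translate of the image of the half-plane `re w < log r` under the
  -- exponential.
  have h : Metric.ball c r \ {c} = (fun w => c + Complex.exp w) '' {w : ℂ | w.re < Real.log r} := by
    ext z
    simp only [Set.mem_sdiff, Metric.mem_ball, dist_eq_norm, Set.mem_singleton_iff, Set.mem_image,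
      Set.mem_ofPred_eq]
    constructor
    · rintro ⟨h1, h2⟩
      have h3 : z - c ≠ 0 := sub_ne_zero.2 h2
      refine ⟨Complex.log (z - c), ?_, ?_⟩
      · rw [Complex.log_re]
        exact Real.log_lt_log (norm_pos_iff.2 h3) h1
      · rw [Complex.exp_log h3]
        ring
    · rintro ⟨w, hw, rfl⟩
      refine ⟨?_, by simp⟩
      rw [add_sub_cancel_left, Complex.norm_exp]
      exact (Real.lt_log_iff_exp_lt hr).1 hw
  rw [h]
  exact (convex_halfSpace_re_lt _).isPreconnected.image _ (by fun_prop)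

/-- The identity theorem on a preconnected set, for a function which may have isolated
singularities of any kind. -/
theorem eventually_eq_zero_of_isPreconnected {f : ℂ → ℂ} {D s : Set ℂ} (hf : AnalyticOnNhd ℂ f D)
    (hs : IsPreconnected s) (hD : ∀ z ∈ s, ∀ᶠ w in 𝓝[≠] z, w ∈ D) {z₀ : ℂ} (hz₀ : z₀ ∈ s)
    (h₀ : ∀ᶠ w in 𝓝[≠] z₀, f w = 0) {z : ℂ} (hz : z ∈ s) : ∀ᶠ w in 𝓝[≠] z, f w = 0 := by
  let u : Set ℂ := {z | ∀ᶠ w in 𝓝[≠] z, f w = 0}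
  have hu : IsOpen u := by
    rw [isOpen_iff_mem_nhds]
    intro a ha
    have h1 : ∀ᶠ b in 𝓝[≠] a, b ∈ u := by
      filter_upwards [eventually_eventually_nhdsWithin.2 ha, self_mem_nhdsWithin] with b hb hba
      rw [(isOpen_compl_singleton (x := a)).nhdsWithin_eq hba] at hb
      exact nhdsWithin_le_nhds hb
    rw [eventually_nhdsWithin_iff] at h1
    filter_upwards [h1] with b hb
    by_cases hba : b = a
    · exact hba ▸ ha
    · exact hb hba
  refine hs.subset_of_closure_inter_subset hu ⟨z₀, hz₀, h₀⟩ ?_ hz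
  rintro a ⟨ha, has⟩
  obtain ⟨r, hr, hrD⟩ := Metric.mem_nhdsWithin_iff.1 (hD a has)
  obtain ⟨b, hb, hbu⟩ := Metric.mem_closure_iff.1 ha r hr
  by_cases hba : b = a
  · exact hba ▸ hb
  have hset : Metric.ball a r \ {a} = Metric.ball a r ∩ {a}ᶜ := rfl
  -- The zero near `b` spreads over the whole punctured disc about `a`, whatever the nature of the
  -- singularity at `a`. This makes `u` relatively closed in `s`.
  have h1 : Set.EqOn f 0 (Metric.ball a r \ {a}) :=
    (hf.mono (hset ▸ hrD)).eqOn_zero_of_preconnected_of_frequently_eq_zero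
      (isPreconnected_ball_diff_center a hr) (z₀ := b)
      ⟨by rwa [Metric.mem_ball, dist_comm], hba⟩ (Filter.Eventually.frequently hb)
  exact Metric.mem_nhdsWithin_iff.2 ⟨r, hr, fun w hw => h1 hw⟩

/-- The union of the open half-planes with a far half-plane is preconnected. -/
theorem isPreconnected_im_ne_zero_or_lt_re (R : ℝ) :
    IsPreconnected {z : ℂ | z.im ≠ 0 ∨ R < z.re} := by
  have h : {z : ℂ | z.im ≠ 0 ∨ R < z.re} =
      ({z : ℂ | 0 < z.im} ∪ {z : ℂ | R < z.re}) ∪ {z : ℂ | z.im < 0} := by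
    ext z
    simp only [Set.mem_ofPred_eq, Set.mem_union, ne_iff_lt_or_gt]
    tauto
  rw [h]
  refine IsPreconnected.union (⟨R + 1, -1⟩ : ℂ) (Or.inr ?_) ?_ (IsPreconnected.union
    (⟨R + 1, 1⟩ : ℂ) ?_ ?_ (convex_halfSpace_im_gt 0).isPreconnected
      (convex_halfSpace_re_gt R).isPreconnected) (convex_halfSpace_im_lt 0).isPreconnected <;>
  simp

/-- A holomorphic function on an open set which contains all far points and all nonreal points up
to isolated ones vanishes if it vanishes near one nonreal point. -/
theorem eq_zero_of_eventually_eq_zero {f : ℂ → ℂ} {D : Set ℂ} (hDo : IsOpen D)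
    (hf : DifferentiableOn ℂ f D) (hD : ∀ z : ℂ, z.im ≠ 0 → ∀ᶠ w in 𝓝[≠] z, w ∈ D) {R : ℝ}
    (hR : ∀ z : ℂ, R < ‖z‖ → z ∈ D) {z₀ : ℂ} (hz₀ : z₀.im ≠ 0) (h₀ : ∀ᶠ w in 𝓝 z₀, f w = 0)
    {z : ℂ} (hz : z ∈ D) : f z = 0 := by
  have hfa : AnalyticOnNhd ℂ f D := hf.analyticOnNhd hDo
  have key : ∀ a : ℂ, a.im ≠ 0 → ∀ᶠ w in 𝓝[≠] a, f w = 0 := fun a ha =>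
    eventually_eq_zero_of_isPreconnected hfa (isPreconnected_im_ne_zero_or_lt_re R)
      (by
        rintro b (hb | hb)
        · exact hD b hb
        · exact nhdsWithin_le_nhds
            (hDo.mem_nhds (hR b (hb.trans_le (Complex.re_le_norm b)))))
      (Or.inl hz₀) (nhdsWithin_le_nhds h₀) (Or.inl ha)
  obtain ⟨r, hr, hrD⟩ := Metric.isOpen_iff.1 hDo z hz
  -- A real `z` need not lie in the connected set treated by `key`, so it is reached from a nonreal
  -- point of a disc inside `D`.
  obtain ⟨a, ha, haim⟩ : ∃ a ∈ Metric.ball z r, a.im ≠ 0 := by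
    by_cases hzi : z.im = 0
    · refine ⟨z + (r / 2 : ℝ) * Complex.I, ?_, ?_⟩
      · simp only [Metric.mem_ball, dist_eq_norm, add_sub_cancel_left, norm_mul,
          Complex.norm_real, Complex.norm_I, mul_one, Real.norm_eq_abs]
        rw [abs_of_pos (by positivity)]
        linarith
      · simp [hzi, hr.ne']
    · exact ⟨z, Metric.mem_ball_self hr, hzi⟩
  exact (hfa.mono hrD).eqOn_zero_of_preconnected_of_frequently_eq_zero
    Metric.isPreconnected_ball ha (key a haim).frequently (Metric.mem_ball_self hr)

section Resolvents

variable {K : Type*} [NormedAddCommGroup K] [InnerProductSpace ℂ K]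

/-! ### Resolvents of linear relations -/

theorem shiftInv_eq_graphRel_iff {T : Submodule ℂ (K × K)} {z : ℂ} {R : K →L[ℂ] K} :
    shiftInv T z = graphRel R ↔ ∀ x y : K, (y, x + z • y) ∈ T ↔ y = R x := by
  have h : ∀ x y : K, (x, y) ∈ shiftInv T z ↔ (y, x + z • y) ∈ T := by
    intro x y
    simp only [shiftInv, Submodule.mem_map, Prod.exists, LinearMap.prod_apply, Function.prod_apply,
      LinearMap.sub_apply, LinearMap.snd_apply, LinearMap.smul_apply, LinearMap.fst_apply,
      Prod.mk.injEq]
    constructor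
    · rintro ⟨f, g, hfg, h1, rfl⟩
      rw [← h1, sub_add_cancel]
      exact hfg
    · intro hT
      exact ⟨y, _, hT, add_sub_cancel_right _ _, rfl⟩
  constructor
  · intro hR x y
    rw [← h, hR]
    simp [graphRel, LinearMap.mem_graph_iff]
  · intro hR
    ext ⟨x, y⟩
    rw [h, hR]
    simp [graphRel, LinearMap.mem_graph_iff]

theorem mem_rho_of_shiftInv_eq {T : Submodule ℂ (K × K)} {z : ℂ} {R : K →L[ℂ] K}
    (h : shiftInv T z = graphRel R) : z ∈ rho T := ⟨R, h⟩

theorem res_eq_of_shiftInv_eq [CompleteSpace K] {T : Submodule ℂ (K × K)} {z : ℂ} {R : K →L[ℂ] K}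
    (h : shiftInv T z = graphRel R) : res T z = R := by
  have h1 := shiftInv_eq_graphRel_res (mem_rho_of_shiftInv_eq h)
  rw [shiftInv_eq_graphRel_iff] at h h1
  ext x
  exact (h x _).1 ((h1 x _).2 rfl)

theorem mk_mem_iff_eq_res [CompleteSpace K] {T : Submodule ℂ (K × K)} {z : ℂ} (hz : z ∈ rho T)
    (x y : K) : (y, x + z • y) ∈ T ↔ y = res T z x :=
  shiftInv_eq_graphRel_iff.1 (shiftInv_eq_graphRel_res hz) x y

/-- A relation is determined by its resolvent at one point. -/
theorem eq_of_res_eq [CompleteSpace K] {T T' : Submodule ℂ (K × K)} {z : ℂ} (hz : z ∈ rho T)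
    (hz' : z ∈ rho T') (h : res T z = res T' z) : T = T' := by
  ext ⟨f, g⟩
  have h1 := mk_mem_iff_eq_res hz (g - z • f) f
  have h2 := mk_mem_iff_eq_res hz' (g - z • f) f
  rw [sub_add_cancel] at h1 h2
  rw [h1, h2, h]

/-- The resolvent at `z` near `a` must be `res T a ∘ (1 - (z - a) res T a)⁻¹`, and the inverse
exists because the units form an open set. -/
theorem isOpen_rho [CompleteSpace K] (T : Submodule ℂ (K × K)) : IsOpen (rho T) := by
  rw [isOpen_iff_mem_nhds]
  intro a ha
  have hc : Filter.Tendsto (fun z : ℂ => (1 : K →L[ℂ] K) - (z - a) • res T a) (𝓝 a) (𝓝 1) := by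
    have : Continuous fun z : ℂ => (1 : K →L[ℂ] K) - (z - a) • res T a := by fun_prop
    simpa using this.tendsto a
  have hu : ∀ᶠ z in 𝓝 a, IsUnit ((1 : K →L[ℂ] K) - (z - a) • res T a) :=
    hc.eventually (Units.isOpen.mem_nhds isUnit_one)
  filter_upwards [hu] with z hz
  obtain ⟨U, hU⟩ := hz
  have h1 : ∀ x, ((U⁻¹ : (K →L[ℂ] K)ˣ) : K →L[ℂ] K) (x - (z - a) • res T a x) = x := by
    intro x
    have := congrArg (fun F : K →L[ℂ] K => F x) U.inv_mul
    simpa [hU] using this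
  have h2 : ∀ x, ((U⁻¹ : (K →L[ℂ] K)ˣ) : K →L[ℂ] K) x
      - (z - a) • res T a (((U⁻¹ : (K →L[ℂ] K)ˣ) : K →L[ℂ] K) x) = x := by
    intro x
    have := congrArg (fun F : K →L[ℂ] K => F x) U.mul_inv
    simpa [hU] using this
  refine mem_rho_of_shiftInv_eq (R := res T a ∘L ((U⁻¹ : (K →L[ℂ] K)ˣ) : K →L[ℂ] K))
    (shiftInv_eq_graphRel_iff.2 fun x y => ?_)
  have h3 : x + z • y = (x + (z - a) • y) + a • y := by
    rw [sub_smul]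
    abel
  rw [h3, mk_mem_iff_eq_res ha, ContinuousLinearMap.comp_apply]
  constructor
  · intro hy
    have h4 := h1 (x + (z - a) • y)
    rw [← hy, add_sub_cancel_right] at h4
    rw [h4]
    exact hy
  · intro hy
    have h4 := h2 x
    rw [← hy] at h4
    have h5 : x + (z - a) • y = ((U⁻¹ : (K →L[ℂ] K)ˣ) : K →L[ℂ] K) x := by
      rw [sub_eq_iff_eq_add] at h4
      exact h4.symm
    rw [h5]
    exact hy

/-! ### Resolvents of bounded operators -/

theorem mk_mem_graphRel {A : K →L[ℂ] K} {x y : K} : (x, y) ∈ graphRel A ↔ y = A x := by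
  simp [graphRel, LinearMap.mem_graph_iff]

/-- The sign comes from the convention of `resolvent`, which is `(z - A)⁻¹`. -/
theorem shiftInv_graphRel_eq_resolvent {A : K →L[ℂ] K} {z : ℂ} (hz : z ∈ resolventSet ℂ A) :
    shiftInv (graphRel A) z = graphRel (-resolvent A z) := by
  rw [spectrum.mem_resolventSet_iff] at hz
  have h1 : ∀ x, resolvent A z (z • x - A x) = x := by
    intro x
    have := congrArg (fun F : K →L[ℂ] K => F x) (Ring.inverse_mul_cancel _ hz)
    simpa [resolvent, Algebra.algebraMap_eq_smul_one] using this
  have h2 : ∀ x, z • resolvent A z x - A (resolvent A z x) = x := by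
    intro x
    have := congrArg (fun F : K →L[ℂ] K => F x) (Ring.mul_inverse_cancel _ hz)
    simpa [resolvent, Algebra.algebraMap_eq_smul_one] using this
  rw [shiftInv_eq_graphRel_iff]
  intro x y
  rw [mk_mem_graphRel, neg_apply]
  constructor
  · intro h
    have h3 := h1 y
    rw [← h, show z • y - (x + z • y) = -x by abel, map_neg] at h3
    exact h3.symm
  · rintro rfl
    have h3 := h2 x
    rw [sub_eq_iff_eq_add] at h3
    rw [smul_neg, map_neg, h3]
    abel

variable [CompleteSpace K]

theorem rho_graphRel (A : K →L[ℂ] K) : rho (graphRel A) = resolventSet ℂ A := by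
  ext z
  constructor
  · intro hz
    have h := mk_mem_iff_eq_res hz
    simp only [mk_mem_graphRel] at h
    rw [spectrum.mem_resolventSet_iff, ContinuousLinearMap.isUnit_iff_bijective,
      Function.bijective_iff_existsUnique]
    intro b
    refine ⟨res (graphRel A) z (-b), ?_, fun y hy => ?_⟩
    · have h1 := (h (-b) _).2 rfl
      simp only [sub_apply, Algebra.algebraMap_eq_smul_one,
        smul_apply, one_apply_eq_self]
      rw [← h1]
      abel
    · simp only [sub_apply, Algebra.algebraMap_eq_smul_one,
        smul_apply, one_apply_eq_self] at hy
      refine (h _ _).1 ?_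
      rw [← hy]
      abel
  · intro hz
    exact mem_rho_of_shiftInv_eq (shiftInv_graphRel_eq_resolvent hz)

theorem res_graphRel {A : K →L[ℂ] K} {z : ℂ} (hz : z ∈ rho (graphRel A)) :
    res (graphRel A) z = -resolvent A z :=
  res_eq_of_shiftInv_eq (shiftInv_graphRel_eq_resolvent (rho_graphRel A ▸ hz))

theorem eq_res_graphRel_iff {A : K →L[ℂ] K} {z : ℂ} (hz : z ∈ rho (graphRel A)) {x y : K} :
    y = res (graphRel A) z x ↔ A y = x + z • y := by
  rw [← mk_mem_iff_eq_res hz, mk_mem_graphRel, eq_comm]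

theorem apply_res_graphRel {A : K →L[ℂ] K} {z : ℂ} (hz : z ∈ rho (graphRel A)) (x : K) :
    A (res (graphRel A) z x) = x + z • res (graphRel A) z x :=
  (eq_res_graphRel_iff hz).1 rfl

theorem smul_res_graphRel_res_graphRel {A : K →L[ℂ] K} {z w : ℂ} (hz : z ∈ rho (graphRel A))
    (hw : w ∈ rho (graphRel A)) (x : K) :
    (z - w) • res (graphRel A) z (res (graphRel A) w x) =
      res (graphRel A) z x - res (graphRel A) w x := by
  rw [eq_sub_iff_add_eq, ← map_smul, eq_comm, ← sub_eq_iff_eq_add', ← map_sub, eq_comm,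
    eq_res_graphRel_iff hz, apply_res_graphRel hw, sub_smul]
  abel

theorem isOpen_rho_graphRel (A : K →L[ℂ] K) : IsOpen (rho (graphRel A)) := isOpen_rho _

theorem differentiableOn_res_graphRel (A : K →L[ℂ] K) :
    DifferentiableOn ℂ (res (graphRel A)) (rho (graphRel A)) := by
  have h : DifferentiableOn ℂ (fun z => -resolvent A z) (rho (graphRel A)) := fun z hz =>
    (spectrum.hasDerivAt_resolvent_const_left
      (rho_graphRel A ▸ hz)).differentiableAt.neg.differentiableWithinAt
  exact h.congr fun z hz => res_graphRel hz

theorem mem_rho_graphRel_of_lt_norm (A : K →L[ℂ] K) {z : ℂ}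
    (hz : ‖A‖ * ‖(1 : K →L[ℂ] K)‖ < ‖z‖) : z ∈ rho (graphRel A) := by
  rw [rho_graphRel]
  exact spectrum.mem_resolventSet_of_norm_lt_mul hz

theorem eventually_mem_rho_graphRel (A : K →L[ℂ] K) :
    ∀ᶠ z in Bornology.cobounded ℂ, z ∈ rho (graphRel A) := by
  filter_upwards [spectrum.eventually_isUnit_resolvent (𝕜 := ℂ) A] with z hz
  rw [rho_graphRel]
  exact spectrum.isUnit_resolvent.2 hz

theorem tendsto_smul_res_graphRel (A : K →L[ℂ] K) :
    Filter.Tendsto (fun z : ℂ => z • res (graphRel A) z) (Bornology.cobounded ℂ) (𝓝 (-1)) := by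
  -- `z (A - z)⁻¹ = -1 + A (A - z)⁻¹`, and the last term tends to zero.
  have h1 : Filter.Tendsto (fun z : ℂ => -(1 + A * resolvent A z)) (Bornology.cobounded ℂ)
      (𝓝 (-1)) := by
    simpa using (((spectrum.resolvent_tendsto_cobounded (𝕜 := ℂ) A).const_mul A).const_add 1).neg
  refine h1.congr' ?_
  filter_upwards [eventually_mem_rho_graphRel A] with z hz
  have h2 := apply_res_graphRel hz
  rw [res_graphRel hz] at h2 ⊢
  ext x
  have h3 := h2 x
  simp only [neg_apply, map_neg] at h3
  simp only [neg_apply, add_apply,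
    one_apply_eq_self, mul_apply_eq_comp, smul_apply]
  rw [neg_add, h3]
  abel

end Resolvents

set_option linter.unusedSectionVars false

section Representation

variable {H K : Type*} [NormedAddCommGroup H] [InnerProductSpace ℂ H] [CompleteSpace H]
  [NormedAddCommGroup K] [InnerProductSpace ℂ K] [CompleteSpace K]

/-! ### Density of the ranges of the field -/

/-- The minimality of a representation is inherited by open sets of parameters which contain a
nonreal point, provided the nonreal spectrum is discrete. -/
theorem topologicalClosure_span_res_eq_top {A : K →L[ℂ] K} {Γ : H →L[ℂ] K}
    (hD : ∀ z : ℂ, z.im ≠ 0 → ∀ᶠ w in 𝓝[≠] z, w ∈ rho (graphRel A))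
    (hmin : (Submodule.span ℂ {x : K | ∃ z ∈ rho (graphRel A),
      ∃ h : H, x = res (graphRel A) z (Γ h)}).topologicalClosure = ⊤)
    {V : Set ℂ} (hV : IsOpen V) {w : ℂ} (hw : w ∈ V) (hwi : w.im ≠ 0) :
    (Submodule.span ℂ {x : K | ∃ z ∈ V,
      ∃ h : H, x = res (graphRel A) z (Γ h)}).topologicalClosure = ⊤ := by
  rw [Submodule.topologicalClosure_eq_top_iff, Submodule.eq_bot_iff] at hmin ⊢
  intro u hu
  refine hmin u ?_
  rw [Submodule.mem_orthogonal'] at hu ⊢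
  -- A vector `u` orthogonal to the smaller span gives a holomorphic function of `z` that vanishes
  -- near `w`, hence on all of `ρ(A)`.
  have key : ∀ h : H, ∀ z ∈ rho (graphRel A), ⟪u, res (graphRel A) z (Γ h)⟫_ℂ = 0 := by
    intro h z hz
    refine eq_zero_of_eventually_eq_zero (f := fun z => ⟪u, res (graphRel A) z (Γ h)⟫_ℂ)
      (isOpen_rho_graphRel A) ?_ hD (fun z hz => mem_rho_graphRel_of_lt_norm A hz) hwi ?_ hz
    · exact (innerSL ℂ u).differentiable.comp_differentiableOn
        ((differentiableOn_res_graphRel A).clm_apply (differentiableOn_const _))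
    · filter_upwards [hV.mem_nhds hw] with v hv
      exact hu _ (Submodule.subset_span ⟨v, hv, h, rfl⟩)
  intro x hx
  induction hx using Submodule.span_induction with
  | mem x hx =>
    obtain ⟨z, hz, h, rfl⟩ := hx
    exact key h z hz
  | zero => simp
  | add x y _ _ hx hy => rw [inner_add_right, hx, hy, add_zero]
  | smul c x _ hx => rw [inner_smul_right, hx, mul_zero]

/-! ### The indefinite scalar product -/

variable {κ : ℕ} {J : K →L[ℂ] K}

theorem ip_conj_symm (hJ : IsPontryagin κ J) (x y : K) : conj (ip J y x) = ip J x y := by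
  rw [ip, ip, inner_conj_symm, ← ContinuousLinearMap.adjoint_inner_right,
    hJ.isSelfAdjoint.adjoint_eq]

theorem eq_zero_of_forall_ip_eq_zero (hJ : IsPontryagin κ J) {k : K} (h : ∀ x, ip J k x = 0) :
    k = 0 := by
  have h1 : J k = 0 := inner_self_eq_zero.1 (h (J k))
  have h2 := congrArg (fun F : K →L[ℂ] K => F k) hJ.sq_eq_one
  simpa [h1] using h2.symm

theorem ip_apply_right {A : K →L[ℂ] K} (hA : IsSelfAdjointRel J (graphRel A)) (x y : K) :
    ip J x (A y) = ip J (A x) y := by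
  have h1 : (x, A x) ∈ graphRel A := mk_mem_graphRel.2 rfl
  rw [hA] at h1
  exact h1 (y, A y) (mk_mem_graphRel.2 rfl)

theorem ip_res_right {A : K →L[ℂ] K} (hA : IsSelfAdjointRel J (graphRel A)) {w : ℂ}
    (hw : w ∈ rho (graphRel A)) (hw' : conj w ∈ rho (graphRel A)) (x y : K) :
    ip J x (res (graphRel A) w y) = ip J (res (graphRel A) (conj w) x) y := by
  have h1 := apply_res_graphRel hw y
  have h2 := apply_res_graphRel hw' x
  have h3 := ip_apply_right hA (res (graphRel A) (conj w) x) (res (graphRel A) w y)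
  rw [h1, h2] at h3
  simp only [ip, map_add, map_smul, inner_add_left, inner_add_right, inner_smul_left,
    inner_smul_right] at h3 ⊢
  exact (add_right_cancel h3).symm

/-! ### The relation that represents `-Q⁻¹` -/

/-- The relation `A_{|(I - P)K} ∔ ({0} × P K)`. -/
def hatRel (J : K →L[ℂ] K) (A : K →L[ℂ] K) (Γ : H →L[ℂ] K) : Submodule ℂ (K × K) :=
  restrictRel A (ran (1 - proj J Γ)) ⊔ Submodule.prod ⊥ (ran (proj J Γ))

variable {A : K →L[ℂ] K} {Γ : H →L[ℂ] K}

theorem inverse_kadj_apply (hG : IsUnit (kadj J Γ ∘L Γ)) (h : H) :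
    Ring.inverse (kadj J Γ ∘L Γ) (kadj J Γ (Γ h)) = h :=
  congrArg (fun F : H →L[ℂ] H => F h) (Ring.inverse_mul_cancel _ hG)

theorem kadj_inverse_apply (hG : IsUnit (kadj J Γ ∘L Γ)) (h : H) :
    kadj J Γ (Γ (Ring.inverse (kadj J Γ ∘L Γ) h)) = h :=
  congrArg (fun F : H →L[ℂ] H => F h) (Ring.mul_inverse_cancel _ hG)

theorem mem_ran_proj (hG : IsUnit (kadj J Γ ∘L Γ)) {x : K} :
    x ∈ ran (proj J Γ) ↔ ∃ h, x = Γ h := by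
  constructor
  · rintro ⟨y, rfl⟩
    exact ⟨_, rfl⟩
  · rintro ⟨h, rfl⟩
    exact ⟨Γ h, congrArg Γ (inverse_kadj_apply hG h)⟩

theorem mem_ran_one_sub_proj (hG : IsUnit (kadj J Γ ∘L Γ)) {x : K} :
    x ∈ ran (1 - proj J Γ) ↔ kadj J Γ x = 0 := by
  constructor
  · rintro ⟨y, rfl⟩
    change kadj J Γ (y - Γ (Ring.inverse (kadj J Γ ∘L Γ) (kadj J Γ y))) = 0
    rw [map_sub, kadj_inverse_apply hG, sub_self]
  · intro hx
    refine ⟨x, ?_⟩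
    change x - Γ (Ring.inverse (kadj J Γ ∘L Γ) (kadj J Γ x)) = x
    simp [hx]

theorem mem_restrictRel {M : Submodule ℂ K} {f g : K} :
    (f, g) ∈ restrictRel A M ↔ f ∈ M ∧ g = A f := by
  simp only [restrictRel, Submodule.mem_map]
  constructor
  · rintro ⟨x, hx, h⟩
    obtain ⟨rfl, rfl⟩ := Prod.ext_iff.1 h
    exact ⟨hx, rfl⟩
  · rintro ⟨hf, rfl⟩
    exact ⟨f, hf, rfl⟩

/-- This description, free of `P`, is the form in which the relation is used below. -/
theorem mem_hatRel (hG : IsUnit (kadj J Γ ∘L Γ)) {f g : K} :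
    (f, g) ∈ hatRel J A Γ ↔ kadj J Γ f = 0 ∧ ∃ h, g = A f + Γ h := by
  rw [hatRel, Submodule.mem_sup]
  constructor
  · rintro ⟨⟨a, b⟩, h1, ⟨c, d⟩, h2, h⟩
    obtain ⟨ha, rfl⟩ := mem_restrictRel.1 h1
    obtain ⟨hc, hd⟩ := Submodule.mem_prod.1 h2
    obtain ⟨k, hk⟩ := (mem_ran_proj hG).1 hd
    obtain ⟨h3, h4⟩ := Prod.ext_iff.1 h
    simp only [Submodule.mem_bot] at hc hk
    simp only [Prod.fst_add, Prod.snd_add, hc, add_zero] at h3 h4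
    subst h3
    exact ⟨(mem_ran_one_sub_proj hG).1 ha, k, by rw [← h4, hk]⟩
  · rintro ⟨hf, h, rfl⟩
    exact ⟨(f, A f), mem_restrictRel.2 ⟨(mem_ran_one_sub_proj hG).2 hf, rfl⟩, (0, Γ h),
      ⟨Submodule.zero_mem _, (mem_ran_proj hG).2 ⟨h, rfl⟩⟩, by simp⟩

theorem infPart_hatRel (hG : IsUnit (kadj J Γ ∘L Γ)) :
    infPart (hatRel J A Γ) = Submodule.prod ⊥ (ran (proj J Γ)) := by
  ext ⟨f, g⟩
  simp only [infPart, Submodule.mem_inf, mem_hatRel hG, Submodule.mem_prod, Submodule.mem_bot,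
    Submodule.mem_top, and_true, mem_ran_proj hG]
  constructor
  · rintro ⟨⟨-, h, rfl⟩, rfl⟩
    exact ⟨rfl, h, by simp⟩
  · rintro ⟨rfl, h, rfl⟩
    exact ⟨⟨by simp, h, by simp⟩, rfl⟩

theorem disjoint_restrictRel_infPart (A : K →L[ℂ] K) (M : Submodule ℂ K)
    (T : Submodule ℂ (K × K)) : Disjoint (restrictRel A M) (infPart T) := by
  rw [Submodule.disjoint_def]
  rintro ⟨f, g⟩ h1 h2
  obtain ⟨-, rfl⟩ := mem_restrictRel.1 h1
  obtain rfl : f = 0 := h2.2.1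
  simp

/-- `ker Γ⁺` and `ran Γ` are orthogonal and together span `K`. Symmetry of `A` and this
orthogonality give one inclusion. For `(k, g)` in the adjoint, testing with `f = 0` gives `Γ⁺ k =
0`; then `v = g - A k` is orthogonal to `ker Γ⁺`, so `v - P v` is orthogonal to both summands and
vanishes by nondegeneracy. -/
theorem isSelfAdjointRel_hatRel (hJ : IsPontryagin κ J) (hA : IsSelfAdjointRel J (graphRel A))
    (hG : IsUnit (kadj J Γ ∘L Γ)) : IsSelfAdjointRel J (hatRel J A Γ) := by
  have hip : ∀ k : K, kadj J Γ k = 0 → ∀ h, ip J k (Γ h) = 0 := by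
    intro k hk h
    rw [← inner_kadj, hk, inner_zero_right]
  have hip' : ∀ k : K, kadj J Γ k = 0 → ∀ h, ip J (Γ h) k = 0 := by
    intro k hk h
    rw [← ip_conj_symm hJ, hip k hk, map_zero]
  have hadd : ∀ x y y' : K, ip J x (y + y') = ip J x y + ip J x y' := by
    intro x y y'
    simp [ip]
  have hadd' : ∀ x x' y : K, ip J (x + x') y = ip J x y + ip J x' y := by
    intro x x' y
    simp [ip]
  refine le_antisymm ?_ ?_
  · rintro ⟨k, g⟩ hk ⟨f, g'⟩ hf
    obtain ⟨hk₀, a, rfl⟩ := (mem_hatRel hG).1 hk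
    obtain ⟨hf₀, b, rfl⟩ := (mem_hatRel hG).1 hf
    change ip J k (A f + Γ b) = ip J (A k + Γ a) f
    rw [hadd, hadd', hip k hk₀, hip' f hf₀, ip_apply_right hA]
  · rintro ⟨k, g⟩ hk
    have hk' : ∀ f, kadj J Γ f = 0 → ∀ h, ip J k (A f + Γ h) = ip J g f := fun f hf h =>
      hk (f, A f + Γ h) ((mem_hatRel hG).2 ⟨hf, h, rfl⟩)
    have h0 : kadj J Γ k = 0 := by
      refine ext_inner_left ℂ fun h => ?_
      have := hk' 0 (map_zero _) h
      rw [inner_kadj, inner_zero_right]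
      simpa [ip] using this
    refine (mem_hatRel hG).2 ⟨h0, Ring.inverse (kadj J Γ ∘L Γ) (kadj J Γ (g - A k)), ?_⟩
    rw [← sub_eq_iff_eq_add', ← sub_eq_zero]
    set v : K := g - A k with hv
    set p : K := Γ (Ring.inverse (kadj J Γ ∘L Γ) (kadj J Γ v)) with hp
    have h1 : kadj J Γ (v - p) = 0 := by rw [map_sub, kadj_inverse_apply hG, sub_self]
    have h2 : ∀ f, kadj J Γ f = 0 → ip J (v - p) f = 0 := by
      intro f hf
      have h3 := hk' f hf 0
      have h4 := hip' f hf (Ring.inverse (kadj J Γ ∘L Γ) (kadj J Γ v))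
      rw [map_zero, add_zero, ip_apply_right hA] at h3
      rw [← hp] at h4
      have h5 : ip J (v - p) f = ip J g f - ip J (A k) f - ip J p f := by
        simp only [hv, ip, map_sub, inner_sub_right]
      rw [h5, h3, h4, sub_self, sub_zero]
    refine eq_zero_of_forall_ip_eq_zero hJ fun x => ?_
    set q : H := Ring.inverse (kadj J Γ ∘L Γ) (kadj J Γ x) with hq
    have h5 : kadj J Γ (x - Γ q) = 0 := by rw [map_sub, hq, kadj_inverse_apply hG, sub_self]
    rw [← sub_add_cancel x (Γ q), hadd, h2 _ h5, hip _ h1, add_zero]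

/-! ### The resolvent set and the resolvent of the representing relation -/

theorem inverse_apply_self {B : H →L[ℂ] H} (hB : IsUnit B) (h : H) :
    Ring.inverse B (B h) = h :=
  congrArg (fun F : H →L[ℂ] H => F h) (Ring.inverse_mul_cancel _ hB)

theorem apply_inverse_self {B : H →L[ℂ] H} (hB : IsUnit B) (h : H) :
    B (Ring.inverse B h) = h :=
  congrArg (fun F : H →L[ℂ] H => F h) (Ring.mul_inverse_cancel _ hB)

variable {Q : ℂ → H →L[ℂ] H}

/-! ### Krein's resolvent formula and the domain of the inverse function -/

theorem mk_mem_hatRel_iff (hG : IsUnit (kadj J Γ ∘L Γ)) {z : ℂ} (hz : z ∈ rho (graphRel A))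
    {x y : K} : (y, x + z • y) ∈ hatRel J A Γ ↔
      kadj J Γ y = 0 ∧ ∃ h, y = res (graphRel A) z (x - Γ h) := by
  rw [mem_hatRel hG]
  refine and_congr_right fun _ => exists_congr fun h => ?_
  rw [eq_res_graphRel_iff hz, eq_comm, ← eq_sub_iff_add_eq, sub_add_eq_add_sub]

theorem shiftInv_hatRel (hG : IsUnit (kadj J Γ ∘L Γ)) (hQ : ∀ z ∈ rho (graphRel A),
      Q z = kadj J Γ ∘L res (graphRel A) z ∘L Γ) {z : ℂ}
    (hz : z ∈ invDomain (rho (graphRel A)) Q) :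
    shiftInv (hatRel J A Γ) z = graphRel (res (graphRel A) z -
      res (graphRel A) z ∘L Γ ∘L Ring.inverse (Q z) ∘L kadj J Γ ∘L res (graphRel A) z) := by
  have hq : ∀ h, kadj J Γ (res (graphRel A) z (Γ h)) = Q z h := fun h => by rw [hQ z hz.1]; rfl
  rw [shiftInv_eq_graphRel_iff]
  intro x y
  rw [mk_mem_hatRel_iff hG hz.1]
  change _ ↔ y = res (graphRel A) z x -
    res (graphRel A) z (Γ (Ring.inverse (Q z) (kadj J Γ (res (graphRel A) z x))))
  constructor
  · rintro ⟨h1, h, rfl⟩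
    rw [map_sub, map_sub, sub_eq_zero, hq] at h1
    rw [h1, inverse_apply_self hz.2, map_sub]
  · rintro rfl
    refine ⟨?_, _, (map_sub _ _ _).symm⟩
    rw [map_sub, hq, apply_inverse_self hz.2, sub_self]

theorem invDomain_eq (hG : IsUnit (kadj J Γ ∘L Γ)) (hQ : ∀ z ∈ rho (graphRel A),
      Q z = kadj J Γ ∘L res (graphRel A) z ∘L Γ) :
    invDomain (rho (graphRel A)) Q = rho (graphRel A) ∩ rho (hatRel J A Γ) := by
  ext z
  refine ⟨fun hz => ⟨hz.1, mem_rho_of_shiftInv_eq (shiftInv_hatRel hG hQ hz)⟩, ?_⟩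
  rintro ⟨hz, hz'⟩
  have hq : ∀ h, kadj J Γ (res (graphRel A) z (Γ h)) = Q z h := fun h => by rw [hQ z hz]; rfl
  have key := fun x y => (mk_mem_iff_eq_res hz' x y).symm.trans (mk_mem_hatRel_iff hG hz)
  refine ⟨hz, ContinuousLinearMap.isUnit_iff_bijective.2 ⟨?_, ?_⟩⟩
  · rw [injective_iff_map_eq_zero]
    intro h hh
    -- If `Q(z) h = 0`, then `-R_z Γ h` solves the homogeneous problem for the hat relation, so it
    -- is zero; hence `Γ h = 0` and `h = 0`.
    have h1 := (key 0 (-res (graphRel A) z (Γ h))).2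
      ⟨by rw [map_neg, hq, hh, neg_zero], h, by rw [zero_sub, map_neg]⟩
    rw [map_zero, neg_eq_zero, eq_comm, eq_res_graphRel_iff hz, map_zero, smul_zero, add_zero] at h1
    rw [← inverse_kadj_apply hG h, ← h1, map_zero, map_zero]
  · intro g
    -- Here `Γ⁺ u = g`. Solving with right-hand side `(A - z) u` gives `y = u - R_z Γ h` with `Γ⁺ y
    -- = 0`, which says `Q(z) h = g`.
    set u : K := Γ (Ring.inverse (kadj J Γ ∘L Γ) g) with hu
    have hru : u = res (graphRel A) z (A u - z • u) := by
      rw [eq_res_graphRel_iff hz, sub_add_cancel]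
    obtain ⟨h1, h, h2⟩ := (key (A u - z • u) _).1 rfl
    refine ⟨h, ?_⟩
    rw [h2, map_sub, ← hru, map_sub, hq, hu, kadj_inverse_apply hG, sub_eq_zero] at h1
    exact h1.symm

/-- By the resolvent equation `(z - w) Γ⁺ R_z R_w Γ = Q(z) - Q(w)`. Inserted into Krein's formula,
the `Q(z)` term cancels and `Q(w)` is absorbed by `Q(w)⁻¹`. -/
theorem fieldAt_hatRel (hG : IsUnit (kadj J Γ ∘L Γ)) (hQ : ∀ z ∈ rho (graphRel A),
      Q z = kadj J Γ ∘L res (graphRel A) z ∘L Γ) {z w : ℂ}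
    (hz : z ∈ invDomain (rho (graphRel A)) Q) (hw : w ∈ invDomain (rho (graphRel A)) Q) :
    hatField A Γ Q z = fieldAt (hatRel J A Γ) w (hatField A Γ Q w) z := by
  have hq : ∀ v ∈ rho (graphRel A), ∀ h,
      kadj J Γ (res (graphRel A) v (Γ h)) = Q v h := fun v hv h => by rw [hQ v hv]; rfl
  ext h
  set k : H := Ring.inverse (Q w) h with hk
  have hk' : Q w k = h := apply_inverse_self hw.2 h
  rw [fieldAt, res_eq_of_shiftInv_eq (shiftInv_hatRel hG hQ hz)]
  change -res (graphRel A) z (Γ (Ring.inverse (Q z) h)) = -res (graphRel A) w (Γ k) + (z - w) •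
    (res (graphRel A) z (-res (graphRel A) w (Γ k)) - res (graphRel A) z (Γ (Ring.inverse (Q z)
      (kadj J Γ (res (graphRel A) z (-res (graphRel A) w (Γ k)))))))
  have h1 := smul_res_graphRel_res_graphRel hz.1 hw.1 (Γ k)
  have h2 : ∀ x, (z - w) • res (graphRel A) z (Γ (Ring.inverse (Q z) (kadj J Γ x))) =
      res (graphRel A) z (Γ (Ring.inverse (Q z) (kadj J Γ ((z - w) • x)))) := fun x => by
    simp only [map_smul]
  simp only [map_neg, smul_sub, smul_neg, h2]
  rw [h1]
  simp only [map_sub, hq _ hz.1, hq _ hw.1, hk', inverse_apply_self hz.2]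
  abel

/-- Since `Γ̂_w⁺ = -Q(w̄)⁻¹ Γ⁺ R_w̄`, the kernel term is `Q(z) - Q(w̄)` between `Q(w̄)⁻¹` and
`Q(z)⁻¹`, that is, `Q(w̄)⁻¹ - Q(z)⁻¹`. -/
theorem negInv_eq (hA : IsSelfAdjointRel J (graphRel A))
    (hQN : IsGenNevanlinna κ (rho (graphRel A)) Q) (hQ : ∀ z ∈ rho (graphRel A),
      Q z = kadj J Γ ∘L res (graphRel A) z ∘L Γ) {z w : ℂ}
    (hz : z ∈ invDomain (rho (graphRel A)) Q) (hw : w ∈ invDomain (rho (graphRel A)) Q) :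
    negInv Q z = ContinuousLinearMap.adjoint (negInv Q w) +
      (z - conj w) • (kadj J (hatField A Γ Q w) ∘L hatField A Γ Q z) := by
  have hq : ∀ v ∈ rho (graphRel A), ∀ h,
      kadj J Γ (res (graphRel A) v (Γ h)) = Q v h := fun v hv h => by rw [hQ v hv]; rfl
  have hw' := hQN.conj_mem w hw.1
  have hQw : star (Q w) = Q (conj w) := hQN.adjoint_eq w hw.1
  have hu : IsUnit (Q (conj w)) := hQw ▸ hw.2.star
  have hinv : ContinuousLinearMap.adjoint (Ring.inverse (Q w)) = Ring.inverse (Q (conj w)) := by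
    rw [← hQw, Ring.inverse_star]
    rfl
  have hkadj : ∀ x, kadj J (hatField A Γ Q w) x =
      -Ring.inverse (Q (conj w)) (kadj J Γ (res (graphRel A) (conj w) x)) := by
    intro x
    refine ext_inner_left ℂ fun h => ?_
    rw [inner_kadj, inner_neg_right, ← hinv, ContinuousLinearMap.adjoint_inner_right, inner_kadj,
      ← ip_res_right hA hw.1 hw']
    change ip J x (-res (graphRel A) w (Γ (Ring.inverse (Q w) h))) = _
    simp [ip]
  ext h
  set k : H := Ring.inverse (Q z) h with hk
  have hk' : Q z k = h := apply_inverse_self hz.2 h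
  have h1 := smul_res_graphRel_res_graphRel hw' hz.1 (Γ k)
  rw [negInv, negInv, map_neg, hinv]
  change -k = -Ring.inverse (Q (conj w)) h + (z - conj w) •
    kadj J (hatField A Γ Q w) (-res (graphRel A) z (Γ k))
  rw [hkadj, map_neg, map_neg, map_neg, neg_neg, ← map_smul, ← map_smul, ← neg_sub (conj w) z,
    neg_smul, h1, map_neg, map_neg, map_sub, hq _ hw', hq _ hz.1, map_sub, hk',
    inverse_apply_self hu]
  abel

/-! ### Existence and uniqueness of the representing relation -/

theorem isOpen_invDomain {D : Set ℂ} (hD : IsOpen D) (hQ : DifferentiableOn ℂ Q D) :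
    IsOpen (invDomain D Q) :=
  hQ.continuousOn.isOpen_inter_preimage hD Units.isOpen

/-- The ranges of the field of `-Q⁻¹` span the same subspace as those of the field of `Q`. -/
theorem res_eq_hatField_apply {v : ℂ} (hv : IsUnit (Q v)) (h : H) :
    res (graphRel A) v (Γ h) = hatField A Γ Q v (-(Q v h)) := by
  change _ = -res (graphRel A) v (Γ (Ring.inverse (Q v) (-(Q v h))))
  rw [map_neg, inverse_apply_self hv, map_neg, map_neg, neg_neg]

theorem isMinimalRepresentation_hatRel (hJ : IsPontryagin κ J)
    (hA : IsSelfAdjointRel J (graphRel A)) (hQN : IsGenNevanlinna κ (rho (graphRel A)) Q)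
    (hQ : ∀ z ∈ rho (graphRel A), Q z = kadj J Γ ∘L res (graphRel A) z ∘L Γ)
    (hmin : (Submodule.span ℂ {x : K | ∃ z ∈ rho (graphRel A),
      ∃ h : H, x = res (graphRel A) z (Γ h)}).topologicalClosure = ⊤)
    (hG : IsUnit (kadj J Γ ∘L Γ))
    (href : ∃ w ∈ invDomain (rho (graphRel A)) Q, 0 < w.im) :
    IsMinimalRepresentation J (invDomain (rho (graphRel A)) Q) (negInv Q) (hatRel J A Γ)
      (hatField A Γ Q) where
  isSelfAdjoint := isSelfAdjointRel_hatRel hJ hA hG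
  exists_ref := by
    obtain ⟨w, hw, hwi⟩ := href
    exact ⟨w, ⟨hw, mem_rho_of_shiftInv_eq (shiftInv_hatRel hG hQ hw)⟩, hwi⟩
  field_eq := fun w hw z hz => fieldAt_hatRel hG hQ hz.1 hw.1
  repr := fun w hw z hz => by
    rw [← fieldAt_hatRel hG hQ hz.1 hw.1]
    exact negInv_eq hA hQN hQ hz.1 hw.1
  minimal := by
    intro w hw
    obtain ⟨v, hv, hvi⟩ := href
    rw [eq_top_iff, ← topologicalClosure_span_res_eq_top hQN.eventually_mem hmin
      (isOpen_invDomain hQN.isOpen hQN.holomorphic) hv hvi.ne']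
    refine Submodule.topologicalClosure_mono (Submodule.span_mono ?_)
    rintro _ ⟨z, hz, h, rfl⟩
    refine ⟨z, mem_rho_of_shiftInv_eq (shiftInv_hatRel hG hQ hz), -(Q z h), ?_⟩
    rw [← fieldAt_hatRel hG hQ hz hw.1, res_eq_hatField_apply hz.2]

/-- There is at most one representing relation, the field of operators being given. -/
theorem eq_hatRel_of_isMinimalRepresentation
    (hQN : IsGenNevanlinna κ (rho (graphRel A)) Q)
    (hQ : ∀ z ∈ rho (graphRel A), Q z = kadj J Γ ∘L res (graphRel A) z ∘L Γ)
    (hmin : (Submodule.span ℂ {x : K | ∃ z ∈ rho (graphRel A),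
      ∃ h : H, x = res (graphRel A) z (Γ h)}).topologicalClosure = ⊤)
    (hG : IsUnit (kadj J Γ ∘L Γ)) {T : Submodule ℂ (K × K)}
    (hT : IsMinimalRepresentation J (invDomain (rho (graphRel A)) Q) (negInv Q) T
      (hatField A Γ Q)) : T = hatRel J A Γ := by
  obtain ⟨w, ⟨hw, hwT⟩, hwi⟩ := hT.exists_ref
  have hw' : w ∈ rho (hatRel J A Γ) := mem_rho_of_shiftInv_eq (shiftInv_hatRel hG hQ hw)
  refine eq_of_res_eq hwT hw' ?_
  -- The point `w` is removed because the factor `w - u` is cancelled at the end.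
  set V : Set ℂ := (invDomain (rho (graphRel A)) Q ∩ rho T) \ {w} with hVdef
  have hVo : IsOpen (invDomain (rho (graphRel A)) Q ∩ rho T) :=
    (isOpen_invDomain hQN.isOpen hQN.holomorphic).inter (isOpen_rho T)
  obtain ⟨v, ⟨hvi, hv⟩, hvw⟩ : ∃ v, (v ∈ {z : ℂ | 0 < z.im} ∧
      v ∈ invDomain (rho (graphRel A)) Q ∩ rho T) ∧ v ≠ w := by
    have h1 : ∀ᶠ v in 𝓝[≠] w, v ∈ {z : ℂ | 0 < z.im} ∧
        v ∈ invDomain (rho (graphRel A)) Q ∩ rho T :=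
      nhdsWithin_le_nhds (Filter.inter_mem
        ((isOpen_lt continuous_const Complex.continuous_im).mem_nhds hwi)
        (hVo.mem_nhds ⟨hw, hwT⟩))
    obtain ⟨v, h2, h3⟩ := (h1.and self_mem_nhdsWithin).exists
    exact ⟨v, h2, h3⟩
  have hdense := topologicalClosure_span_res_eq_top hQN.eventually_mem hmin
    (hVo.sdiff isClosed_singleton) (show v ∈ V from ⟨hv, hvw⟩) (ne_of_gt hvi)
  refine ContinuousLinearMap.ext_on (Submodule.dense_iff_topologicalClosure_eq_top.2 hdense) ?_
  rintro _ ⟨u, ⟨⟨hu, huT⟩, huw⟩, h, rfl⟩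
  -- The roles are exchanged: the reference point `u` varies while the resolvents are compared at
  -- the fixed point `w`.
  have h1 := (hT.field_eq u ⟨hu, huT⟩ w ⟨hw, hwT⟩).symm.trans (fieldAt_hatRel hG hQ hw hu)
  have h2 := congrArg (fun F : H →L[ℂ] K => F (-(Q u h))) h1
  simp only [fieldAt, ContinuousLinearMap.comp_apply, add_apply, one_apply_eq_self, smul_apply,
    ← res_eq_hatField_apply hu.2, add_right_inj] at h2
  exact smul_right_injective K (sub_ne_zero.2 (Ne.symm huw)) h2

/-! ### Behaviour at infinity -/

/-- The behaviour of `Q` at infinity. -/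
theorem tendsto_smul_cobounded
    (hQ : ∀ z ∈ rho (graphRel A), Q z = kadj J Γ ∘L res (graphRel A) z ∘L Γ) :
    Filter.Tendsto (fun z : ℂ => z • Q z) (Bornology.cobounded ℂ) (𝓝 (-(kadj J Γ ∘L Γ))) := by
  have hc : Continuous fun R : K →L[ℂ] K => kadj J Γ ∘L R ∘L Γ := by fun_prop
  have h1 := (hc.tendsto (-1)).comp (tendsto_smul_res_graphRel A)
  have h2 : kadj J Γ ∘L (-1 : K →L[ℂ] K) ∘L Γ = -(kadj J Γ ∘L Γ) := by
    ext
    simp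
  rw [h2] at h1
  refine h1.congr' ?_
  filter_upwards [eventually_mem_rho_graphRel A] with z hz
  rw [hQ z hz]
  ext
  simp

theorem exists_mem_invDomain_im_pos {B : H →L[ℂ] H} (hB : IsUnit B)
    (hlim : Filter.Tendsto (fun z : ℂ => z • Q z) (Bornology.cobounded ℂ) (𝓝 B)) :
    ∃ w ∈ invDomain (rho (graphRel A)) Q, 0 < w.im := by
  have h1 : ∀ᶠ z in Bornology.cobounded ℂ, z ∈ rho (graphRel A) ∧ IsUnit (z • Q z) :=
    (eventually_mem_rho_graphRel A).and (hlim.eventually (Units.isOpen.mem_nhds hB))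
  obtain ⟨r, -, hr⟩ := Filter.atTop_basis_Ioi.cobounded_of_norm.eventually_iff.1 h1
  have hpos : 0 < |r| + 1 := by positivity
  -- A point on the positive imaginary axis, beyond the radius `r` outside which `z Q(z)` is
  -- invertible.
  set z : ℂ := ((|r| + 1 : ℝ) : ℂ) * Complex.I with hz
  obtain ⟨h2, h3⟩ := @hr z (by
    simp only [Set.mem_preimage, Set.mem_Ioi, hz, norm_mul, Complex.norm_I, mul_one,
      Complex.norm_real, Real.norm_eq_abs]
    rw [abs_of_pos hpos]
    linarith [le_abs_self r])
  have hz0 : z ≠ 0 := mul_ne_zero (Complex.ofReal_ne_zero.2 hpos.ne') Complex.I_ne_zero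
  refine ⟨z, ⟨h2, ?_⟩, ?_⟩
  · exact (isUnit_smul_iff (Units.mk0 z hz0) (Q z)).1 h3
  · rw [hz, Complex.im_ofReal_mul, Complex.I_im, mul_one]
    exact hpos

end Representation

end PontryaginRep

end

theorem lemma3p4 {H K : Type*}
    [NormedAddCommGroup H] [InnerProductSpace ℂ H] [CompleteSpace H]
    [NormedAddCommGroup K] [InnerProductSpace ℂ K] [CompleteSpace K]
    (κ : ℕ) (J : K →L[ℂ] K) (hJ : PontryaginRep.IsPontryagin κ J)
    (A : K →L[ℂ] K) (hA : PontryaginRep.IsSelfAdjointRel J (PontryaginRep.graphRel A))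
    (Γ : H →L[ℂ] K)
    (Q : ℂ → H →L[ℂ] H)
    (hQN : PontryaginRep.IsGenNevanlinna κ (PontryaginRep.rho (PontryaginRep.graphRel A)) Q)
    (hQ : ∀ z ∈ PontryaginRep.rho (PontryaginRep.graphRel A),
      Q z = PontryaginRep.kadj J Γ ∘L PontryaginRep.res (PontryaginRep.graphRel A) z ∘L Γ)
    (hmin : (Submodule.span ℂ {x : K | ∃ z ∈ PontryaginRep.rho (PontryaginRep.graphRel A),
      ∃ h : H, x = PontryaginRep.res (PontryaginRep.graphRel A) z (Γ h)}).topologicalClosure = ⊤)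
    (Q'inf : H →L[ℂ] H)
    (hlim : Filter.Tendsto (fun z : ℂ => z • Q z) (Bornology.cobounded ℂ) (nhds Q'inf))
    (hinv : IsUnit Q'inf) :
    Q'inf = -(PontryaginRep.kadj J Γ ∘L Γ) ∧
    -- the asserted relation is a representing relation of `-Q⁻¹`
    PontryaginRep.IsMinimalRepresentation J
      (PontryaginRep.invDomain (PontryaginRep.rho (PontryaginRep.graphRel A)) Q)
      (PontryaginRep.negInv Q)
      (PontryaginRep.restrictRel A (PontryaginRep.ran (1 - PontryaginRep.proj J Γ)) ⊔
        Submodule.prod ⊥ (PontryaginRep.ran (PontryaginRep.proj J Γ)))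
      (PontryaginRep.hatField A Γ Q) ∧
    -- every representing relation of `-Q⁻¹` is the asserted one
    ∀ Ahat : Submodule ℂ (K × K),
      PontryaginRep.IsMinimalRepresentation J
        (PontryaginRep.invDomain (PontryaginRep.rho (PontryaginRep.graphRel A)) Q)
        (PontryaginRep.negInv Q) Ahat (PontryaginRep.hatField A Γ Q) →
      Ahat = PontryaginRep.restrictRel A (PontryaginRep.ran (1 - PontryaginRep.proj J Γ)) ⊔
        PontryaginRep.infPart Ahat ∧
      Disjoint (PontryaginRep.restrictRel A (PontryaginRep.ran (1 - PontryaginRep.proj J Γ)))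
        (PontryaginRep.infPart Ahat) ∧
      PontryaginRep.infPart Ahat =
        Submodule.prod ⊥ (PontryaginRep.ran (PontryaginRep.proj J Γ)) ∧
      PontryaginRep.invDomain (PontryaginRep.rho (PontryaginRep.graphRel A)) Q =
        PontryaginRep.rho (PontryaginRep.graphRel A) ∩ PontryaginRep.rho Ahat := by
  have hQ'inf : Q'inf = -(PontryaginRep.kadj J Γ ∘L Γ) :=
    tendsto_nhds_unique hlim (PontryaginRep.tendsto_smul_cobounded hQ)
  have hG : IsUnit (PontryaginRep.kadj J Γ ∘L Γ) := by
    rw [hQ'inf] at hinv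
    simpa using hinv.neg
  refine ⟨hQ'inf, PontryaginRep.isMinimalRepresentation_hatRel hJ hA hQN hQ hmin hG
    (PontryaginRep.exists_mem_invDomain_im_pos hinv hlim), fun Ahat hAhat => ?_⟩
  obtain rfl := PontryaginRep.eq_hatRel_of_isMinimalRepresentation hQN hQ hmin hG hAhat
  refine ⟨?_, PontryaginRep.disjoint_restrictRel_infPart _ _ _, PontryaginRep.infPart_hatRel hG,
    PontryaginRep.invDomain_eq hG hQ⟩
  rw [PontryaginRep.infPart_hatRel hG]
  rfl
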